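/- A join-semilattice $S$ with zero is called $\{0\}$-representable if there is a lattice $L$ with zero such that $S\cong\mathrm{Con}_c L$, the join-semilattice of compact congruences of $L$. For join-semilattices $S$, $T$ with zero, a bi-ideal of $S\times T$ is a hereditary subset that contains $(S\times\{0\})\cup(\{0\}\times T)$ and is closed under joins in each coordinate; the tensor product $S\otimes T$ is the join-semilattice with zero of all compact elements of the lattice of bi-ideals of $S\times T$, and for $s\in S$, $t\in T$ we put $s\otimes t=\{(x,y): x\le s,\ y\le t\}\cup(S\times\{0\})\cup(\{0\}\times T)$. For lattices $A$, $B$ with zero and $(a,b)\in A\times B$, let $a\mathbin{\square} b=\{(x,y)\in A\times B: x\le a\text{ or }y\le b\}$ and $a\boxtimes b=\{(x,y)\in A\times B: x\le a,\ y\le b\}\cup(A\times\{0\})\cup(\{0\}\times B)$; the lattice tensor product $A\boxtimes B$ is the set, ordered by containment, of all intersections of finite nonempty families of sets $a\mathbin{\square} b$ that are contained in some $a'\boxtimes b'$. It is a lattice with zero that contains all the sets $a\boxtimes b$. Let $\Theta_L(x,y)$ denote the least congruence of the lattice $L$ identifying $x$ and $y$. **Theorem A.** Let $S$ and $T$ be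 join-semilattices with zero. If $S$ and $T$ are $\{0\}$-representable, then $S\otimes T$ is $\{0\}$-representable. More precisely, if $A$ and $B$ are lattices with zero and $f\colon\mathrm{Con}_c A\to S$, $g\colon\mathrm{Con}_c B\to T$ are isomorphisms, then there is a unique isomorphism $\mu\colon S\otimes T\to\mathrm{Con}_c(A\boxtimes B)$ such that $$\mu\bigl(f(\Theta_A(a_0,a_1))\otimes g(\Theta_B(b_0,b_1))\bigr)=\Theta_{A\boxtimes B}\bigl((a_0\boxtimes b_1)\vee(a_1\boxtimes b_0),\ a_1\boxtimes b_1\bigr)$$ for all $a_0\le a_1$ in $A$ and all $b_0\le b_1$ in $B$. -/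

import Mathlib

universe w₁ w₂ u₁ u₂

/-! ### Lattice congruences, ordered by containment -/

namespace LatticeCon

variable {L : Type*} [Lattice L]

theorem toSetoid_injective :
    Function.Injective (LatticeCon.toSetoid : LatticeCon L → Setoid L) := by
  rintro ⟨s, _, _⟩ ⟨t, _, _⟩ h
  cases h
  rfl

/-- `θ ≤ ψ` means that `θ` is contained in `ψ` (as sets of pairs). -/
instance : PartialOrder (LatticeCon L) :=
  PartialOrder.lift LatticeCon.toSetoid toSetoid_injective

theorem le_iff {θ ψ : LatticeCon L} : θ ≤ ψ ↔ ∀ ⦃x y : L⦄, θ.r x y → ψ.r x y :=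
  Iff.rfl

/-- The intersection of a set of congruences. -/
instance : InfSet (LatticeCon L) where
  sInf s :=
    { r := fun x y => ∀ θ ∈ s, θ.r x y
      iseqv :=
        ⟨fun x θ _ => θ.iseqv.refl x, fun h θ hθ => θ.iseqv.symm (h θ hθ),
          fun h k θ hθ => θ.iseqv.trans (h θ hθ) (k θ hθ)⟩
      inf := fun h k θ hθ => θ.inf (h θ hθ) (k θ hθ)
      sup := fun h k θ hθ => θ.sup (h θ hθ) (k θ hθ) }

theorem isGLB_sInf (s : Set (LatticeCon L)) : IsGLB s (sInf s) :=
  ⟨fun θ hθ _ _ h => h θ hθ, fun _ hψ _ _ h _ hθ => hψ hθ h⟩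

/-- The congruence lattice `Con L`. -/
instance : CompleteLattice (LatticeCon L) :=
  completeLatticeOfInf (LatticeCon L) isGLB_sInf

/-- The principal congruence `Θ_L(x, y)`: the least congruence identifying `x` and `y`. -/
def principal (x y : L) : LatticeCon L :=
  sInf {θ | θ.r x y}

theorem principal_le_iff {x y : L} {θ : LatticeCon L} : principal x y ≤ θ ↔ θ.r x y :=
  ⟨fun h => h fun _ hψ => hψ, fun h _ _ k => k θ h⟩

/-- A directed union of congruences is a congruence, and hence is the least upper bound. -/
theorem rel_of_isLUB {s : Set (LatticeCon L)} (hne : s.Nonempty) (hd : DirectedOn (· ≤ ·) s)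
    {u : LatticeCon L} (hu : IsLUB s u) {x y : L} (h : u.r x y) : ∃ θ ∈ s, θ.r x y := by
  let U : LatticeCon L :=
    { r := fun x y => ∃ θ ∈ s, θ.r x y
      iseqv := by
        refine ⟨fun x => ?_, ?_, ?_⟩
        · obtain ⟨θ, hθ⟩ := hne
          exact ⟨θ, hθ, θ.iseqv.refl x⟩
        · rintro x y ⟨θ, hθ, h⟩
          exact ⟨θ, hθ, θ.iseqv.symm h⟩
        · rintro x y z ⟨θ, hθ, h⟩ ⟨ψ, hψ, k⟩
          obtain ⟨χ, hχ, h1, h2⟩ := hd θ hθ ψ hψ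
          exact ⟨χ, hχ, χ.iseqv.trans (h1 h) (h2 k)⟩
      inf := by
        rintro w x y z ⟨θ, hθ, h⟩ ⟨ψ, hψ, k⟩
        obtain ⟨χ, hχ, h1, h2⟩ := hd θ hθ ψ hψ
        exact ⟨χ, hχ, χ.inf (h1 h) (h2 k)⟩
      sup := by
        rintro w x y z ⟨θ, hθ, h⟩ ⟨ψ, hψ, k⟩
        obtain ⟨χ, hχ, h1, h2⟩ := hd θ hθ ψ hψ
        exact ⟨χ, hχ, χ.sup (h1 h) (h2 k)⟩ }
  have hU : u ≤ U := hu.2 fun θ hθ _ _ h => ⟨θ, hθ, h⟩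
  exact hU h

theorem isCompactElement_principal (x y : L) : IsCompactElement (principal x y) := by
  intro s u hne hd hu h
  obtain ⟨θ, hθ, k⟩ := rel_of_isLUB hne hd hu (principal_le_iff.1 h)
  exact ⟨θ, hθ, principal_le_iff.2 k⟩

end LatticeCon

/-! ### Compact elements, and the semilattice of compact congruences -/

/-- In a complete lattice the compact elements contain the least element. -/
theorem isCompactElement_bot_of_completeLattice {α : Type*} [CompleteLattice α] :
    IsCompactElement (⊥ : α) := by
  intro s u hne _ _ _
  obtain ⟨c, hc⟩ := hne
  exact ⟨c, hc, bot_le⟩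

/-- In a complete lattice the compact elements are closed under binary joins. -/
theorem isCompactElement_sup_of_completeLattice {α : Type*} [CompleteLattice α] {a b : α}
    (ha : IsCompactElement a) (hb : IsCompactElement b) : IsCompactElement (a ⊔ b) := by
  intro s u hne hd hu h
  obtain ⟨c, hc, hac⟩ := ha s u hne hd hu (le_sup_left.trans h)
  obtain ⟨d, hd', hbd⟩ := hb s u hne hd hu (le_sup_right.trans h)
  obtain ⟨e, he, hce, hde⟩ := hd c hc d hd'
  exact ⟨e, he, sup_le (hac.trans hce) (hbd.trans hde)⟩

/-- The `{∨,0}`-semilattice `Con_c L` of all compact congruences of a lattice `L`. -/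
abbrev ConC (L : Type*) [Lattice L] : Type _ :=
  {θ : LatticeCon L // IsCompactElement θ}

instance ConC.instSemilatticeSup (L : Type*) [Lattice L] : SemilatticeSup (ConC L) :=
  Subtype.semilatticeSup fun _ _ => isCompactElement_sup_of_completeLattice

instance ConC.instOrderBot (L : Type*) [Lattice L] : OrderBot (ConC L) :=
  Subtype.orderBot isCompactElement_bot_of_completeLattice

/-- The principal congruence `Θ_L(x, y)` as an element of `Con_c L`. -/
def ConC.principal {L : Type*} [Lattice L] (x y : L) : ConC L :=
  ⟨LatticeCon.principal x y, LatticeCon.isCompactElement_principal x y⟩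

/-- A join-semilattice `S` with zero is `{0}`-representable if there is a lattice `L` with zero
(here `L` lives in the universe `w`) such that `Con_c L ≅ S`.  An order isomorphism between
join-semilattices with zero is the same as an isomorphism of `{∨,0}`-semilattices. -/
def IsZeroRepresentable.{w, u} (S : Type u) [SemilatticeSup S] [OrderBot S] : Prop :=
  ∃ (L : Type w) (_ : Lattice L) (_ : OrderBot L), Nonempty (ConC L ≃o S)

/-! ### The tensor product of join-semilattices with zero -/

/-- A bi-ideal of `S × T`: a hereditary subset that contains `(S × {0}) ∪ ({0} × T)` and is closed
under joins in each of the two coordinates. -/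
@[ext]
structure BiIdeal (S T : Type*) [SemilatticeSup S] [OrderBot S] [SemilatticeSup T] [OrderBot T]
    where
  carrier : Set (S × T)
  right_bot_mem : ∀ s : S, (s, (⊥ : T)) ∈ carrier
  left_bot_mem : ∀ t : T, ((⊥ : S), t) ∈ carrier
  hereditary : IsLowerSet carrier
  left_sup_mem : ∀ ⦃s₀ s₁ : S⦄ ⦃t : T⦄, (s₀, t) ∈ carrier → (s₁, t) ∈ carrier →
    (s₀ ⊔ s₁, t) ∈ carrier
  right_sup_mem : ∀ ⦃s : S⦄ ⦃t₀ t₁ : T⦄, (s, t₀) ∈ carrier → (s, t₁) ∈ carrier →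
    (s, t₀ ⊔ t₁) ∈ carrier

namespace BiIdeal

variable {S T : Type*} [SemilatticeSup S] [OrderBot S] [SemilatticeSup T] [OrderBot T]

/-- Bi-ideals are ordered by containment. -/
instance : PartialOrder (BiIdeal S T) :=
  PartialOrder.lift BiIdeal.carrier fun _ _ h => BiIdeal.ext h

/-- The intersection of a set of bi-ideals. -/
instance : InfSet (BiIdeal S T) where
  sInf F :=
    { carrier := {p | ∀ I ∈ F, p ∈ I.carrier}
      right_bot_mem := fun s I _ => I.right_bot_mem s
      left_bot_mem := fun t I _ => I.left_bot_mem t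
      hereditary := fun _ _ hpq hp I hI => I.hereditary hpq (hp I hI)
      left_sup_mem := fun _ _ _ h k I hI => I.left_sup_mem (h I hI) (k I hI)
      right_sup_mem := fun _ _ _ h k I hI => I.right_sup_mem (h I hI) (k I hI) }

theorem isGLB_sInf (F : Set (BiIdeal S T)) : IsGLB F (sInf F) :=
  ⟨fun I hI _ hp => hp I hI, fun _ hJ _ hp _ hI => hJ hI hp⟩

/-- The extended tensor product: the complete lattice of all bi-ideals of `S × T`. -/
instance : CompleteLattice (BiIdeal S T) :=
  completeLatticeOfInf (BiIdeal S T) isGLB_sInf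

/-- The pure tensor `s ⊗ t = {(x, y) | x ≤ s and y ≤ t} ∪ (S × {0}) ∪ ({0} × T)`. -/
def pure (s : S) (t : T) : BiIdeal S T where
  carrier := {p | (p.1 ≤ s ∧ p.2 ≤ t) ∨ p.1 = ⊥ ∨ p.2 = ⊥}
  right_bot_mem _ := Or.inr (Or.inr rfl)
  left_bot_mem _ := Or.inr (Or.inl rfl)
  hereditary := by
    rintro ⟨x, y⟩ ⟨x', y'⟩ ⟨hx, hy⟩ h
    simp only [Set.mem_ofPred_eq] at h hx hy ⊢
    rcases h with ⟨h1, h2⟩ | rfl | rfl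
    · exact Or.inl ⟨hx.trans h1, hy.trans h2⟩
    · exact Or.inr (Or.inl (le_bot_iff.1 hx))
    · exact Or.inr (Or.inr (le_bot_iff.1 hy))
  left_sup_mem := by
    rintro x₀ x₁ y (⟨h1, h2⟩ | h | h) (⟨k1, k2⟩ | k | k) <;> simp_all
  right_sup_mem := by
    rintro x y₀ y₁ (⟨h1, h2⟩ | h | h) (⟨k1, k2⟩ | k | k) <;> simp_all

theorem pure_le_iff {s : S} {t : T} {I : BiIdeal S T} : pure s t ≤ I ↔ (s, t) ∈ I.carrier := by
  constructor
  · intro h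
    exact h (Or.inl ⟨le_rfl, le_rfl⟩)
  · rintro h ⟨x, y⟩ (⟨hx, hy⟩ | hx | hy)
    · exact I.hereditary (Prod.mk_le_mk.2 ⟨hx, hy⟩) h
    · obtain rfl : x = ⊥ := hx
      exact I.left_bot_mem y
    · obtain rfl : y = ⊥ := hy
      exact I.right_bot_mem x

theorem isCompactElement_pure (s : S) (t : T) : IsCompactElement (pure s t) := by
  intro F u hne hd hu h
  let U : BiIdeal S T :=
    { carrier := {p | ∃ I ∈ F, p ∈ I.carrier}
      right_bot_mem := fun s => hne.imp fun I hI => ⟨hI, I.right_bot_mem s⟩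
      left_bot_mem := fun t => hne.imp fun I hI => ⟨hI, I.left_bot_mem t⟩
      hereditary := fun _ _ hpq => fun ⟨I, hI, hp⟩ => ⟨I, hI, I.hereditary hpq hp⟩
      left_sup_mem := by
        rintro _ _ _ ⟨I, hI, h⟩ ⟨J, hJ, k⟩
        obtain ⟨K, hK, h1, h2⟩ := hd I hI J hJ
        exact ⟨K, hK, K.left_sup_mem (h1 h) (h2 k)⟩
      right_sup_mem := by
        rintro _ _ _ ⟨I, hI, h⟩ ⟨J, hJ, k⟩
        obtain ⟨K, hK, h1, h2⟩ := hd I hI J hJ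
        exact ⟨K, hK, K.right_sup_mem (h1 h) (h2 k)⟩ }
  have hU : u ≤ U := hu.2 fun I hI _ hp => ⟨I, hI, hp⟩
  obtain ⟨I, hI, hp⟩ := hU (pure_le_iff.1 h)
  exact ⟨I, hI, pure_le_iff.2 hp⟩

end BiIdeal

/-- The tensor product `S ⊗ T` of two join-semilattices with zero: the `{∨,0}`-semilattice of all
compact elements of the lattice of bi-ideals of `S × T`. -/
abbrev SemilatticeTensor (S T : Type*) [SemilatticeSup S] [OrderBot S] [SemilatticeSup T]
    [OrderBot T] : Type _ :=
  {I : BiIdeal S T // IsCompactElement I}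

namespace SemilatticeTensor

variable {S T : Type*} [SemilatticeSup S] [OrderBot S] [SemilatticeSup T] [OrderBot T]

instance : SemilatticeSup (SemilatticeTensor S T) :=
  Subtype.semilatticeSup fun _ _ => isCompactElement_sup_of_completeLattice

instance : OrderBot (SemilatticeTensor S T) :=
  Subtype.orderBot isCompactElement_bot_of_completeLattice

/-- The pure tensor `s ⊗ t` as an element of `S ⊗ T`. -/
def tmul (s : S) (t : T) : SemilatticeTensor S T :=
  ⟨BiIdeal.pure s t, BiIdeal.isCompactElement_pure s t⟩

end SemilatticeTensor

/-! ### The box product and the lattice tensor product of lattices with zero -/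

/-- The pure box `a □ b = {(x, y) | x ≤ a or y ≤ b}`. -/
def pureBox {A B : Type*} [Lattice A] [Lattice B] (a : A) (b : B) : Set (A × B) :=
  {p | p.1 ≤ a ∨ p.2 ≤ b}

/-- `H` is an element of the box product `A □ B`: a finite intersection of pure boxes, over a
nonempty index set. -/
def IsBoxElement {A B : Type*} [Lattice A] [Lattice B] (H : Set (A × B)) : Prop :=
  ∃ s : Finset (A × B), s.Nonempty ∧ H = ⋂ p ∈ s, pureBox p.1 p.2

/-- The pure lattice tensor `a ⊠ b = {(x, y) | x ≤ a and y ≤ b} ∪ (A × {0}) ∪ ({0} × B)`. -/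
def pureLatticeTensor {A B : Type*} [Lattice A] [OrderBot A] [Lattice B] [OrderBot B]
    (a : A) (b : B) : Set (A × B) :=
  {p | (p.1 ≤ a ∧ p.2 ≤ b) ∨ p.1 = ⊥ ∨ p.2 = ⊥}

/-- A subset of `A × B` is confined if it is contained in some pure lattice tensor. -/
def IsConfined {A B : Type*} [Lattice A] [OrderBot A] [Lattice B] [OrderBot B]
    (H : Set (A × B)) : Prop :=
  ∃ (a : A) (b : B), H ⊆ pureLatticeTensor a b

/-- The box closure of `X`: the intersection of all pure boxes that contain `X`. -/
def boxClosure {A B : Type*} [Lattice A] [Lattice B] (X : Set (A × B)) : Set (A × B) :=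
  {p | ∀ (a : A) (b : B), X ⊆ pureBox a b → p ∈ pureBox a b}

/-- The lattice tensor product `A ⊠ B`: the set of all confined elements of `A □ B`. -/
def LatticeTensor (A B : Type*) [Lattice A] [OrderBot A] [Lattice B] [OrderBot B] : Type _ :=
  {H : Set (A × B) // IsBoxElement H ∧ IsConfined H}

namespace LatticeTensor

theorem subset_boxClosure {A B : Type*} [Lattice A] [Lattice B] (X : Set (A × B)) : X ⊆ boxClosure X :=
  fun _ hp _ _ h => h hp

theorem boxClosure_subset {A B : Type*} [Lattice A] [Lattice B] {X H : Set (A × B)} (hH : IsBoxElement H) (h : X ⊆ H) :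
    boxClosure X ⊆ H := by
  obtain ⟨s, -, rfl⟩ := hH
  intro p hp
  simp only [Set.mem_iInter]
  intro q hq
  refine hp q.1 q.2 fun x hx => ?_
  exact Set.mem_iInter₂.1 (h hx) q hq

variable {A B : Type*} [Lattice A] [OrderBot A] [Lattice B] [OrderBot B]

theorem pureLatticeTensor_subset_pureBox {a c : A} {b d : B} :
    pureLatticeTensor c d ⊆ pureBox a b ↔ (c, d) ∈ pureBox a b := by
  constructor
  · intro h
    exact h (Or.inl ⟨le_rfl, le_rfl⟩)
  · rintro h ⟨x, y⟩ (⟨hx, hy⟩ | hx | hy)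
    · rcases h with h | h
      · exact Or.inl (hx.trans h)
      · exact Or.inr (hy.trans h)
    · obtain rfl : x = ⊥ := hx
      exact Or.inl bot_le
    · obtain rfl : y = ⊥ := hy
      exact Or.inr bot_le

/-- The box closure of a finite set of points is a confined element of `A □ B`. -/
theorem boxClosure_finset (t : Finset (A × B)) :
    IsBoxElement (boxClosure (t : Set (A × B))) ∧ IsConfined (boxClosure (t : Set (A × B))) := by
  classical
  have hmem : ∀ X ⊆ t, (t : Set (A × B)) ⊆ pureBox (X.sup Prod.fst) ((t \ X).sup Prod.snd) := by
    intro X hX p hp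
    by_cases hpX : p ∈ X
    · exact Or.inl (Finset.le_sup (f := Prod.fst) hpX)
    · exact Or.inr (Finset.le_sup (f := Prod.snd) (Finset.mem_sdiff.2 ⟨hp, hpX⟩))
  constructor
  · refine ⟨t.powerset.image fun X => (X.sup Prod.fst, (t \ X).sup Prod.snd),
      ⟨_, Finset.mem_image_of_mem _ (Finset.empty_mem_powerset t)⟩, ?_⟩
    apply Set.Subset.antisymm
    · intro p hp
      simp only [Set.mem_iInter, Finset.mem_image, Finset.mem_powerset]
      rintro _ ⟨X, hX, rfl⟩
      exact hp _ _ (hmem X hX)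
    · intro p hp a b hab
      have h := Set.mem_iInter₂.1 hp _ (Finset.mem_image_of_mem _
        (Finset.mem_powerset.2 (Finset.filter_subset (fun q : A × B => q.1 ≤ a) t)))
      rcases h with h | h
      · refine Or.inl (h.trans (Finset.sup_le fun q hq => (Finset.mem_filter.1 hq).2))
      · refine Or.inr (h.trans (Finset.sup_le fun q hq => ?_))
        rw [Finset.mem_sdiff, Finset.mem_filter] at hq
        rcases hab (Finset.mem_coe.2 hq.1) with h' | h'
        · exact absurd ⟨hq.1, h'⟩ hq.2
        · exact h'
  · refine ⟨t.sup Prod.fst, t.sup Prod.snd, fun p hp => ?_⟩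
    have h1 := hp _ _ (hmem t (Finset.Subset.refl t))
    have h2 := hp _ _ (hmem ∅ (Finset.empty_subset t))
    simp only [pureBox, Finset.sdiff_self, Finset.sup_empty, Finset.sdiff_empty, le_bot_iff,
      Set.mem_ofPred_eq] at h1 h2
    rcases h1 with h1 | h1
    · rcases h2 with h2 | h2
      · exact Or.inr (Or.inl h2)
      · exact Or.inl ⟨h1, h2⟩
    · exact Or.inr (Or.inr h1)

/-- Every confined element of `A □ B` is a finite union of pure lattice tensors. -/
theorem exists_eq_biUnion {H : Set (A × B)} (hH : IsBoxElement H) (hc : IsConfined H) :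
    ∃ t : Finset (A × B), H = ⋃ q ∈ t, pureLatticeTensor q.1 q.2 := by
  classical
  obtain ⟨s, -, rfl⟩ := hH
  obtain ⟨a, b, hab⟩ := hc
  have key : ∀ s : Finset (A × B), ∃ t : Finset (A × B),
      (⋂ p ∈ s, pureBox p.1 p.2) ∩ pureLatticeTensor a b =
        ⋃ q ∈ t, pureLatticeTensor q.1 q.2 := by
    intro s
    induction s using Finset.induction_on with
    | empty => exact ⟨{(a, b)}, by simp⟩
    | insert r s hr ih =>
      obtain ⟨t, ht⟩ := ih
      refine ⟨t.image (fun q => (q.1 ⊓ r.1, q.2)) ∪ t.image (fun q => (q.1, q.2 ⊓ r.2)), ?_⟩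
      rw [Finset.set_biInter_insert, Set.inter_assoc, ht]
      ext ⟨x, y⟩
      simp only [Set.mem_inter_iff, Set.mem_iUnion, Finset.mem_union, Finset.mem_image,
        pureBox, pureLatticeTensor, Set.mem_ofPred_eq, exists_prop]
      constructor
      · rintro ⟨h | h, q, hq, ⟨h1, h2⟩ | h0⟩
        · exact ⟨_, Or.inl ⟨q, hq, rfl⟩, Or.inl ⟨le_inf h1 h, h2⟩⟩
        · exact ⟨_, Or.inl ⟨q, hq, rfl⟩, Or.inr h0⟩
        · exact ⟨_, Or.inr ⟨q, hq, rfl⟩, Or.inl ⟨h1, le_inf h2 h⟩⟩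
        · exact ⟨_, Or.inr ⟨q, hq, rfl⟩, Or.inr h0⟩
      · rintro ⟨_, ⟨q, hq, rfl⟩ | ⟨q, hq, rfl⟩, ⟨h1, h2⟩ | h0⟩
        · exact ⟨Or.inl (h1.trans inf_le_right), q, hq, Or.inl ⟨h1.trans inf_le_left, h2⟩⟩
        · exact ⟨h0.imp (fun h => h.le.trans bot_le) (fun h => h.le.trans bot_le),
            q, hq, Or.inr h0⟩
        · exact ⟨Or.inr (h2.trans inf_le_right), q, hq, Or.inl ⟨h1, h2.trans inf_le_left⟩⟩
        · exact ⟨h0.imp (fun h => h.le.trans bot_le) (fun h => h.le.trans bot_le),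
            q, hq, Or.inr h0⟩
  obtain ⟨t, ht⟩ := key s
  exact ⟨t, by rw [← ht, Set.inter_eq_left.2 hab]⟩

theorem boxClosure_biUnion (t : Finset (A × B)) :
    boxClosure (⋃ q ∈ t, pureLatticeTensor q.1 q.2) = boxClosure (t : Set (A × B)) := by
  ext p
  refine forall₂_congr fun a b => imp_congr_left ?_
  simp only [Set.iUnion_subset_iff, pureLatticeTensor_subset_pureBox]
  rfl

theorem boxClosure_union_mem (H K : LatticeTensor A B) :
    IsBoxElement (boxClosure (H.1 ∪ K.1)) ∧ IsConfined (boxClosure (H.1 ∪ K.1)) := by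
  classical
  obtain ⟨t, ht⟩ := exists_eq_biUnion H.2.1 H.2.2
  obtain ⟨u, hu⟩ := exists_eq_biUnion K.2.1 K.2.2
  have h : H.1 ∪ K.1 = ⋃ q ∈ t ∪ u, pureLatticeTensor q.1 q.2 := by
    rw [ht, hu, Finset.set_biUnion_union]
  rw [h, boxClosure_biUnion]
  exact boxClosure_finset _

theorem inter_mem (H K : LatticeTensor A B) :
    IsBoxElement (H.1 ∩ K.1) ∧ IsConfined (H.1 ∩ K.1) := by
  classical
  constructor
  · obtain ⟨s, hs, h⟩ := H.2.1
    obtain ⟨t, -, k⟩ := K.2.1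
    exact ⟨s ∪ t, hs.mono Finset.subset_union_left, by
        rw [h, k]
        exact (Finset.iInf_union (f := fun p : A × B => pureBox p.1 p.2)).symm⟩
  · obtain ⟨a, b, h⟩ := H.2.2
    exact ⟨a, b, Set.inter_subset_left.trans h⟩

/-- `A ⊠ B` is ordered by containment. -/
instance : PartialOrder (LatticeTensor A B) :=
  PartialOrder.lift (fun H => H.1) Subtype.val_injective

/-- `A ⊠ B` is a lattice: the meet is the intersection and the join is the box closure of the
union. -/
instance : Lattice (LatticeTensor A B) where
  sup H K := ⟨boxClosure (H.1 ∪ K.1), boxClosure_union_mem H K⟩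
  inf H K := ⟨H.1 ∩ K.1, inter_mem H K⟩
  le_sup_left H K := Set.subset_union_left.trans (subset_boxClosure (H.1 ∪ K.1))
  le_sup_right H K := Set.subset_union_right.trans (subset_boxClosure (H.1 ∪ K.1))
  sup_le _ _ M h k := boxClosure_subset M.2.1 (Set.union_subset h k)
  inf_le_left _ _ := Set.inter_subset_left
  inf_le_right _ _ := Set.inter_subset_right
  le_inf _ _ _ h k := Set.subset_inter h k

theorem pureLatticeTensor_eq (a : A) (b : B) :
    pureLatticeTensor a b = pureBox a ⊥ ∩ pureBox ⊥ b := by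
  ext ⟨x, y⟩
  simp only [pureLatticeTensor, pureBox, Set.mem_inter_iff, Set.mem_ofPred_eq, le_bot_iff]
  constructor
  · rintro (⟨h, k⟩ | rfl | rfl) <;> simp_all
  · tauto

/-- The pure lattice tensor `a ⊠ b` as an element of `A ⊠ B`. -/
def tmul (a : A) (b : B) : LatticeTensor A B :=
  ⟨pureLatticeTensor a b,
    by
      classical
      exact ⟨{(a, ⊥), (⊥, b)}, by simp, by simp [pureLatticeTensor_eq]⟩,
    ⟨a, b, Set.Subset.rfl⟩⟩

/-- The zero of `A ⊠ B` is `0 ⊠ 0 = (A × {0}) ∪ ({0} × B)`. -/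
instance : OrderBot (LatticeTensor A B) where
  bot := tmul ⊥ ⊥
  bot_le H := by
    rintro ⟨x, y⟩ h
    obtain ⟨s, -, hs⟩ := H.2.1
    have h' : x = ⊥ ∨ y = ⊥ := by
      rcases h with ⟨h, -⟩ | h
      · exact Or.inl (le_bot_iff.1 h)
      · exact h
    change (x, y) ∈ H.1
    rw [hs]
    refine Set.mem_iInter₂.2 fun p _ => ?_
    exact h'.imp (fun h => h.le.trans bot_le) (fun h => h.le.trans bot_le)

end LatticeTensor

/-! Compact elements are preserved by order isomorphisms, so it suffices to identify the whole
lattice Con(A ⊠ B) with the lattice of bi-ideals of Con_c A × Con_c B (`LatticeTensor.conOrderIso`).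

Every element of A ⊠ B is both a finite union of pure tensors a ⊠ b and a finite intersection of
boxes a' □ b'. Hence a congruence Θ, viewed as a preorder, is determined by the quadruples for which
a ⊠ b lies in a' □ b' modulo Θ (`le_iff_forall_leBox`). For fixed b, b' this relation between a and
a' is the preorder of a congruence of A, and symmetrically for B. It therefore depends only on the
least congruences forcing a ≤ a' and b ≤ b', and the pairs of compact congruences obtained in this
way form a bi-ideal.

Conversely, a bi-ideal I dictates when H ≤ K should hold: all pairs arising from a tensor in H and a
box around K must lie in I (`LeMod`). That this is a preorder compatible with joins and meets is the
main point. It rests on `BiIdeal.mem_of_forall_subset`, a cut rule that comes from the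
distributivity of Con A.

Uniqueness holds because the tensors of principal congruences generate S ⊗ T under joins. -/

/-! ### Congruences as preorders -/

namespace LatticeCon

variable {L : Type*} [Lattice L] {θ ψ : LatticeCon L} {a b c x y : L}

/-- The preorder of a congruence: `θ.Le a b` means that `a ≤ b` holds modulo `θ`. -/
def Le (θ : LatticeCon L) (a b : L) : Prop := θ.r (a ⊓ b) a

theorem Le.of_le (h : a ≤ b) : θ.Le a b := by
  unfold Le
  rw [inf_eq_left.2 h]

theorem rel_iff_le : θ.r a b ↔ θ.Le a b ∧ θ.Le b a := by
  constructor
  · intro h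
    refine ⟨?_, ?_⟩
    · simpa [Le] using θ.inf (θ.iseqv.refl a) (θ.iseqv.symm h)
    · simpa [Le] using θ.inf (θ.iseqv.refl b) h
  · rintro ⟨h, k⟩
    unfold Le at k
    rw [inf_comm] at k
    exact θ.iseqv.trans (θ.iseqv.symm h) k

theorem le_iff_rel_sup : θ.Le a b ↔ θ.r (a ⊔ b) b := by
  constructor
  · intro h
    have := θ.sup (θ.iseqv.symm h) (θ.iseqv.refl b)
    rwa [sup_eq_right.2 (inf_le_right : a ⊓ b ≤ b)] at this
  · intro h
    have := θ.inf (θ.iseqv.refl a) (θ.iseqv.symm h)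
    rwa [inf_eq_left.2 (le_sup_left : a ≤ a ⊔ b)] at this

theorem Le.trans (h : θ.Le a b) (k : θ.Le b c) : θ.Le a c := by
  have h1 : θ.r (a ⊓ b ⊓ c) (a ⊓ b) := by
    have := θ.inf (θ.iseqv.refl a) k
    rwa [← inf_assoc] at this
  have h2 : θ.r (a ⊓ b ⊓ c) (a ⊓ c) := θ.inf h (θ.iseqv.refl c)
  exact θ.iseqv.trans (θ.iseqv.symm h2) (θ.iseqv.trans h1 h)

theorem Le.inf (h : θ.Le a b) (k : θ.Le a c) : θ.Le a (b ⊓ c) := by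
  have := θ.inf h k
  rwa [inf_idem, ← inf_inf_distrib_left] at this

theorem Le.sup (h : θ.Le a c) (k : θ.Le b c) : θ.Le (a ⊔ b) c := by
  rw [le_iff_rel_sup] at *
  have := θ.sup h k
  rwa [sup_idem, ← sup_sup_distrib_right] at this

theorem Le.mono (h : θ ≤ ψ) (k : θ.Le a b) : ψ.Le a b := h k

theorem le_of_forall_le (h : ∀ a b, θ.Le a b → ψ.Le a b) : θ ≤ ψ := fun _ _ k =>
  rel_iff_le.2 ((rel_iff_le.1 k).imp (h _ _) (h _ _))

/-- The congruence of a preorder that extends the order and respects joins and meets. -/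
def ofPreorder (R : L → L → Prop) (of_le : ∀ ⦃a b⦄, a ≤ b → R a b)
    (trans : ∀ ⦃a b c⦄, R a b → R b c → R a c)
    (sup : ∀ ⦃a b c⦄, R a c → R b c → R (a ⊔ b) c)
    (inf : ∀ ⦃a b c⦄, R a b → R a c → R a (b ⊓ c)) : LatticeCon L where
  r a b := R a b ∧ R b a
  iseqv := ⟨fun _ => ⟨of_le le_rfl, of_le le_rfl⟩, And.symm,
    fun h k => ⟨trans h.1 k.1, trans k.2 h.2⟩⟩
  inf h k := ⟨inf (trans (of_le inf_le_left) h.1) (trans (of_le inf_le_right) k.1),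
    inf (trans (of_le inf_le_left) h.2) (trans (of_le inf_le_right) k.2)⟩
  sup h k := ⟨sup (trans h.1 (of_le le_sup_left)) (trans k.1 (of_le le_sup_right)),
    sup (trans h.2 (of_le le_sup_left)) (trans k.2 (of_le le_sup_right))⟩

theorem ofPreorder_le {R : L → L → Prop} (of_le : ∀ ⦃a b⦄, a ≤ b → R a b)
    (trans : ∀ ⦃a b c⦄, R a b → R b c → R a c)
    (sup : ∀ ⦃a b c⦄, R a c → R b c → R (a ⊔ b) c)
    (inf : ∀ ⦃a b c⦄, R a b → R a c → R a (b ⊓ c)) :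
    (ofPreorder R of_le trans sup inf).Le a b ↔ R a b :=
  ⟨fun h => trans h.2 (of_le inf_le_right), fun h => ⟨of_le inf_le_left, inf (of_le le_rfl) h⟩⟩

/-! ### Meets and joins of congruences, and distributivity. -/

theorem inf_rel_iff : (θ ⊓ ψ).r x y ↔ θ.r x y ∧ ψ.r x y := by
  constructor
  · exact fun h => ⟨(inf_le_left : θ ⊓ ψ ≤ θ) h, (inf_le_right : θ ⊓ ψ ≤ ψ) h⟩
  · intro h
    have h1 : principal x y ≤ θ ⊓ ψ :=
      le_inf (principal_le_iff.2 h.1) (principal_le_iff.2 h.2)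
    exact principal_le_iff.1 h1

/-- The transitive closure of the union of two congruences. -/
theorem reflTransGen_of_sup_rel (h : (θ ⊔ ψ).r x y) :
    Relation.ReflTransGen (fun a b => θ.r a b ∨ ψ.r a b) x y := by
  have lift : ∀ (p : L → L), (∀ (χ : LatticeCon L) (a b : L), χ.r a b → χ.r (p a) (p b)) →
      ∀ {x y}, Relation.ReflTransGen (fun a b => θ.r a b ∨ ψ.r a b) x y →
      Relation.ReflTransGen (fun a b => θ.r a b ∨ ψ.r a b) (p x) (p y) := fun p hp x y h =>
    h.lift p fun a b => Or.imp (hp θ a b) (hp ψ a b)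
  let U : LatticeCon L :=
    { r := Relation.ReflTransGen fun a b => θ.r a b ∨ ψ.r a b
      iseqv := ⟨fun _ => .refl, fun h => by
        have hs : ∀ a b, (θ.r a b ∨ ψ.r a b) → (θ.r b a ∨ ψ.r b a) := fun a b =>
          Or.imp θ.iseqv.symm ψ.iseqv.symm
        induction h with
        | refl => exact .refl
        | tail _ h ih => exact ih.head (hs _ _ h), .trans⟩
      inf := fun {w x y z} h k =>
        (lift (· ⊓ y) (fun χ _ _ h => χ.inf h (χ.iseqv.refl y)) h).trans
          (lift (x ⊓ ·) (fun χ _ _ h => χ.inf (χ.iseqv.refl x) h) k)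
      sup := fun {w x y z} h k =>
        (lift (· ⊔ y) (fun χ _ _ h => χ.sup h (χ.iseqv.refl y)) h).trans
          (lift (x ⊔ ·) (fun χ _ _ h => χ.sup (χ.iseqv.refl x) h) k) }
  have hU : θ ⊔ ψ ≤ U := sup_le (fun _ _ h => .single (Or.inl h)) (fun _ _ h => .single (Or.inr h))
  exact hU h

/-- The congruence lattice of a lattice is distributive. -/
theorem inf_sup_le (χ θ ψ : LatticeCon L) : χ ⊓ (θ ⊔ ψ) ≤ χ ⊓ θ ⊔ χ ⊓ ψ := by
  intro x y h
  obtain ⟨h1, h2⟩ := inf_rel_iff.1 h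
  set s := x ⊓ y
  set t := x ⊔ y
  have hs : s ≤ t := inf_le_sup
  have hχ : χ.r s t := (r_inf_sup_iff χ).2 h1
  -- The polynomial `(a ⊔ s) ⊓ t` pushes a chain of `θ`- and `ψ`-steps from `s` to `t` into the
  -- interval [s, t]. That interval is collapsed by `χ`, so each projected step lies in `χ ⊓ θ` or
  -- in `χ ⊓ ψ`.
  have hp : ∀ φ : LatticeCon L, ∀ {a b}, φ.r a b → φ.r ((a ⊔ s) ⊓ t) ((b ⊔ s) ⊓ t) :=
    fun φ a b h => φ.inf (φ.sup h (φ.iseqv.refl s)) (φ.iseqv.refl t)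
  have hc : ∀ a, χ.r ((a ⊔ s) ⊓ t) s := by
    intro a
    have := χ.inf (χ.iseqv.refl (a ⊔ s)) hχ
    rw [inf_eq_right.2 (le_sup_right : s ≤ a ⊔ s)] at this
    exact χ.iseqv.symm this
  have key : ∀ c, Relation.ReflTransGen (fun a b => θ.r a b ∨ ψ.r a b) s c →
      (χ ⊓ θ ⊔ χ ⊓ ψ).r ((s ⊔ s) ⊓ t) ((c ⊔ s) ⊓ t) := by
    intro c h3
    induction h3 with
    | refl => exact Setoid.refl' _ _
    | @tail b c _ h ih =>
      refine Setoid.trans' _ ih ?_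
      have hbc : χ.r ((b ⊔ s) ⊓ t) ((c ⊔ s) ⊓ t) := χ.iseqv.trans (hc b) (χ.iseqv.symm (hc c))
      rcases h with h | h
      · exact (le_sup_left : χ ⊓ θ ≤ _) (inf_rel_iff.2 ⟨hbc, hp θ h⟩)
      · exact (le_sup_right : χ ⊓ ψ ≤ _) (inf_rel_iff.2 ⟨hbc, hp ψ h⟩)
  have hst := key t (reflTransGen_of_sup_rel ((r_inf_sup_iff (θ ⊔ ψ)).2 h2))
  rw [sup_idem, inf_eq_left.2 hs, sup_eq_left.2 hs, inf_idem] at hst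
  exact (r_inf_sup_iff _).1 hst

end LatticeCon

/-! ### Compact elements -/

/-- If every compact element is a join of elements with a property that holds at `⊥` and is
inherited by binary joins, then all compact elements have the property. -/
theorem IsCompactElement.induction {α : Type*} [CompleteLattice α] {P : α → Prop} {k : α}
    (hk : IsCompactElement k) (bot : P ⊥) (sup : ∀ a b, P a → P b → P (a ⊔ b))
    (le : k ≤ sSup {a | P a ∧ a ≤ k}) : P k := by
  obtain ⟨a, ⟨ha, hak⟩, hka⟩ := hk {a | P a ∧ a ≤ k} _ ⟨⊥, bot, bot_le⟩
    (fun a ha b hb => ⟨a ⊔ b, ⟨sup a b ha.1 hb.1, sup_le ha.2 hb.2⟩, le_sup_left, le_sup_right⟩)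
    (isLUB_sSup _) le
  rwa [le_antisymm hka hak]

theorem OrderIso.isCompactElement_apply {α β : Type*} [PartialOrder α] [PartialOrder β]
    (e : α ≃o β) {k : α} (hk : IsCompactElement k) : IsCompactElement (e k) := by
  intro s u hne hd hu h
  obtain ⟨x, hx, hkx⟩ := hk (e ⁻¹' s) (e.symm u)
    (by obtain ⟨y, hy⟩ := hne; exact ⟨e.symm y, by simpa using hy⟩)
    (by
      intro a ha b hb
      obtain ⟨c, hc, h1, h2⟩ := hd _ ha _ hb
      exact ⟨e.symm c, by simpa using hc, e.le_symm_apply.2 h1, e.le_symm_apply.2 h2⟩)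
    (by
      refine ⟨fun a ha => (e.le_symm_apply).2 (hu.1 ha), fun b hb => ?_⟩
      rw [e.symm_apply_le]
      refine hu.2 fun y hy => ?_
      rw [← e.symm_apply_le]
      exact hb (by simpa using hy))
    (by rwa [e.le_symm_apply])
  exact ⟨e x, hx, e.monotone hkx⟩

/-- An isomorphism restricts to an isomorphism of the posets of compact elements. -/
def OrderIso.compacts {α β : Type*} [PartialOrder α] [PartialOrder β] (e : α ≃o β) :
    {k : α // IsCompactElement k} ≃o {k : β // IsCompactElement k} where
  toFun k := ⟨e k, e.isCompactElement_apply k.2⟩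
  invFun k := ⟨e.symm k, e.symm.isCompactElement_apply k.2⟩
  left_inv k := by simp
  right_inv k := by simp
  map_rel_iff' := by
    intro a b
    exact e.le_iff_le

/-! ### Compact congruences -/

namespace ConC

variable {L : Type*} [Lattice L]

/-- The least congruence modulo which `a ≤ b`, as a compact congruence. -/
def principalLe (a b : L) : ConC L := principal (a ⊓ b) a

theorem principalLe_le_iff {a b : L} {θ : ConC L} : principalLe a b ≤ θ ↔ θ.1.Le a b :=
  LatticeCon.principal_le_iff

theorem principalLe_val_le_iff {a b : L} {θ : LatticeCon L} :
    (principalLe a b).1 ≤ θ ↔ θ.Le a b :=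
  LatticeCon.principal_le_iff

theorem le_principalLe (a b : L) : (principalLe a b).1.Le a b :=
  principalLe_le_iff.1 le_rfl

theorem principalLe_of_le {a b : L} (h : a ≤ b) : principalLe a b = ⊥ :=
  le_bot_iff.1 (principalLe_le_iff.2 (.of_le h))

theorem principal_eq_principalLe {a b : L} (h : a ≤ b) : principal a b = principalLe b a := by
  rw [principalLe, inf_eq_right.2 h]

/-- Every compact congruence is a finite join of principal congruences. -/
theorem induction {P : ConC L → Prop} (bot : P ⊥) (principalLe : ∀ a b, P (principalLe a b))
    (sup : ∀ α β, P α → P β → P (α ⊔ β)) (α : ConC L) : P α := by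
  obtain ⟨α, hα⟩ := α
  -- `P` is defined only on compact congruences, so the predicate used in the induction carries the
  -- compactness proof along.
  have h : ∃ h, P ⟨α, h⟩ := by
    refine hα.induction (P := fun α => ∃ h, P ⟨α, h⟩)
      ⟨_, bot⟩ (fun a b ⟨_, ha⟩ ⟨_, hb⟩ => ⟨_, sup _ _ ha hb⟩) ?_
    refine LatticeCon.le_of_forall_le fun a b hab => ?_
    exact principalLe_val_le_iff.1 (le_sSup ⟨⟨_, principalLe a b⟩, principalLe_val_le_iff.2 hab⟩)
  exact h.2

end ConC

/-! ### Bi-ideals -/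

namespace BiIdeal

variable {S T : Type*} [SemilatticeSup S] [OrderBot S] [SemilatticeSup T] [OrderBot T]

/-- Every compact bi-ideal is a finite join of pure tensors. -/
theorem _root_.SemilatticeTensor.induction {P : SemilatticeTensor S T → Prop} (bot : P ⊥)
    (tmul : ∀ s t, P (SemilatticeTensor.tmul s t))
    (sup : ∀ I J, P I → P J → P (I ⊔ J)) (I : SemilatticeTensor S T) : P I := by
  obtain ⟨I, hI⟩ := I
  have h : ∃ h, P ⟨I, h⟩ := by
    refine hI.induction (P := fun I => ∃ h, P ⟨I, h⟩)
      ⟨_, bot⟩ (fun a b ⟨_, ha⟩ ⟨_, hb⟩ => ⟨_, sup _ _ ha hb⟩) ?_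
    rintro ⟨s, t⟩ hst
    exact pure_le_iff.1 (le_sSup ⟨⟨_, tmul s t⟩, pure_le_iff.2 hst⟩)
  exact h.2

theorem pure_bot_left (t : T) : pure (⊥ : S) t = ⊥ :=
  le_bot_iff.1 (pure_le_iff.2 (left_bot_mem _ t))

theorem pure_bot_right (s : S) : pure s (⊥ : T) = ⊥ :=
  le_bot_iff.1 (pure_le_iff.2 (right_bot_mem _ s))

theorem pure_sup_left (s s' : S) (t : T) : pure (s ⊔ s') t = pure s t ⊔ pure s' t :=
  le_antisymm
    (pure_le_iff.2 (left_sup_mem _ (pure_le_iff.1 le_sup_left) (pure_le_iff.1 le_sup_right)))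
    (sup_le (pure_le_iff.2 (Or.inl ⟨le_sup_left, le_rfl⟩))
      (pure_le_iff.2 (Or.inl ⟨le_sup_right, le_rfl⟩)))

theorem pure_sup_right (s : S) (t t' : T) : pure s (t ⊔ t') = pure s t ⊔ pure s t' :=
  le_antisymm
    (pure_le_iff.2 (right_sup_mem _ (pure_le_iff.1 le_sup_left) (pure_le_iff.1 le_sup_right)))
    (sup_le (pure_le_iff.2 (Or.inl ⟨le_rfl, le_sup_left⟩))
      (pure_le_iff.2 (Or.inl ⟨le_rfl, le_sup_right⟩)))

/-- Isomorphic semilattices have isomorphic lattices of bi-ideals. -/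
def congr {S' T' : Type*} [SemilatticeSup S'] [OrderBot S'] [SemilatticeSup T'] [OrderBot T']
    (f : S ≃o S') (g : T ≃o T') : BiIdeal S T ≃o BiIdeal S' T' where
  toFun I :=
    { carrier := {p | (f.symm p.1, g.symm p.2) ∈ I.carrier}
      right_bot_mem := fun s => by simpa using I.right_bot_mem _
      left_bot_mem := fun t => by simpa using I.left_bot_mem _
      hereditary := fun p q h hp =>
        I.hereditary (Prod.mk_le_mk.2 ⟨f.symm.monotone h.1, g.symm.monotone h.2⟩) hp
      left_sup_mem := fun s s' t h k => by
        simpa only [Set.mem_ofPred_eq, map_sup] using I.left_sup_mem h k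
      right_sup_mem := fun s s' t h k => by
        simpa only [Set.mem_ofPred_eq, map_sup] using I.right_sup_mem h k }
  invFun I :=
    { carrier := {p | (f p.1, g p.2) ∈ I.carrier}
      right_bot_mem := fun s => by simpa using I.right_bot_mem _
      left_bot_mem := fun t => by simpa using I.left_bot_mem _
      hereditary := fun p q h hp =>
        I.hereditary (Prod.mk_le_mk.2 ⟨f.monotone h.1, g.monotone h.2⟩) hp
      left_sup_mem := fun s s' t h k => by
        simpa only [Set.mem_ofPred_eq, map_sup] using I.left_sup_mem h k
      right_sup_mem := fun s s' t h k => by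
        simpa only [Set.mem_ofPred_eq, map_sup] using I.right_sup_mem h k }
  left_inv I := by ext; simp
  right_inv I := by ext; simp
  map_rel_iff' := by
    intro I J
    refine ⟨fun h p hp => ?_, fun h p hp => h hp⟩
    have := @h (f p.1, g p.2) (by simpa using hp)
    simpa using this

/-! ### Bi-ideals as antitone maps into Con A, and the cut rule. -/

variable {A : Type*} [Lattice A]

/-- The join of all congruences that are paired with `t` in the bi-ideal `I`. -/
def leftCon (I : BiIdeal (ConC A) T) (t : T) : LatticeCon A :=
  sSup (Subtype.val '' {α : ConC A | (α, t) ∈ I.carrier})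

/-- The compact congruences paired with `t` form an ideal of Con_c A, so a compact congruence below
their join is below one of them. Thus `I` is encoded by the map `I.leftCon` into Con A, where meets
exist; meets of compact congruences need not be compact. -/
theorem le_leftCon_iff {I : BiIdeal (ConC A) T} {α : ConC A} {t : T} :
    α.1 ≤ I.leftCon t ↔ (α, t) ∈ I.carrier := by
  constructor
  · intro h
    obtain ⟨_, ⟨β, hβ, rfl⟩, hαβ⟩ := α.2 (Subtype.val '' {α : ConC A | (α, t) ∈ I.carrier}) _
      ⟨_, ⊥, I.left_bot_mem t, rfl⟩
      (by
        rintro _ ⟨β, hβ, rfl⟩ _ ⟨β', hβ', rfl⟩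
        exact ⟨_, ⟨β ⊔ β', I.left_sup_mem hβ hβ', rfl⟩,
          (le_sup_left : β ≤ β ⊔ β'), (le_sup_right : β' ≤ β ⊔ β')⟩)
      (isLUB_sSup _) h
    exact I.hereditary (Prod.mk_le_mk.2 ⟨hαβ, le_rfl⟩) hβ
  · exact fun h => le_sSup ⟨α, h, rfl⟩

theorem leftCon_anti (I : BiIdeal (ConC A) T) {t t' : T} (h : t ≤ t') :
    I.leftCon t' ≤ I.leftCon t :=
  sSup_le_sSup (Set.image_mono fun _ hα => I.hereditary (Prod.mk_le_mk.2 ⟨le_rfl, h⟩) hα)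

theorem le_of_forall_principalLe {θ ψ : LatticeCon A}
    (h : ∀ a b, (ConC.principalLe a b).1 ≤ θ → (ConC.principalLe a b).1 ≤ ψ) : θ ≤ ψ :=
  LatticeCon.le_of_forall_le fun a b => by simpa only [ConC.principalLe_val_le_iff] using h a b

theorem inf_leftCon_le (I : BiIdeal (ConC A) T) (t t' : T) :
    I.leftCon t ⊓ I.leftCon t' ≤ I.leftCon (t ⊔ t') :=
  le_of_forall_principalLe fun _ _ h => le_leftCon_iff.2 (I.right_sup_mem
    (le_leftCon_iff.1 (h.trans inf_le_left)) (le_leftCon_iff.1 (h.trans inf_le_right)))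

/-- The cut rule for bi-ideals, stated for an antitone map into a distributive lattice. -/
theorem cut {D : Type*} [Lattice D] [OrderBot D]
    (hD : ∀ x y z : D, x ⊓ (y ⊔ z) ≤ x ⊓ y ⊔ x ⊓ z) {γ : T → D} (anti : Antitone γ)
    (inf_le : ∀ t t', γ t ⊓ γ t' ≤ γ (t ⊔ t')) {ι : Type*} [DecidableEq ι] (J : Finset ι)
    {u : ι → D} {v : ι → T} (hJ : ∀ i ∈ J, u i ≤ γ (v i)) (b : T) :
    ∀ {a a₀ : D} {b₀ : T}, a₀ ≤ γ b → a ≤ γ b₀ →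
      (∀ X ⊆ J, ∃ a' b', a' ≤ γ b' ∧ a ≤ a₀ ⊔ a' ⊔ X.sup u ∧ b ≤ b₀ ⊔ b' ⊔ (J \ X).sup v) →
      a ≤ γ b := by
  -- Here `a₀` collects the part of `a` already known to lie below `γ b`, and `b₀` the part of `b`
  -- already known to be paired with `a`. Both vary in the induction.
  induction J using Finset.induction_on with
  | empty =>
    intro a a₀ b₀ h₀ h₁ h
    obtain ⟨a', b', h', ha, hb⟩ := h ∅ le_rfl
    simp only [Finset.sdiff_self, Finset.sup_empty, sup_bot_eq] at ha hb
    calc a ≤ a ⊓ (a₀ ⊔ a') := le_inf le_rfl ha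
      _ ≤ a ⊓ a₀ ⊔ a ⊓ a' := hD _ _ _
      _ ≤ γ b := sup_le (inf_le_right.trans h₀)
        ((inf_le_inf h₁ h').trans ((inf_le _ _).trans (anti hb)))
  | insert k J hk ih =>
    intro a a₀ b₀ h₀ h₁ h
    have ih' := @ih fun i hi => hJ i (Finset.mem_insert_of_mem hi)
    have huv := hJ k (Finset.mem_insert_self k J)
    -- The subsets that omit `k` have `v k` on the right-hand side. It can be absorbed into `b₀`
    -- once `a` is cut down to `a ⊓ u k`, since `u k ≤ γ (v k)`.
    have h2 : a ⊓ u k ≤ γ b := by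
      refine ih' (a₀ := a₀) (b₀ := b₀ ⊔ v k) h₀ ((inf_le_inf h₁ huv).trans (inf_le _ _)) ?_
      intro X hX
      obtain ⟨a', b', h', ha, hb⟩ := h X (hX.trans (Finset.subset_insert k J))
      refine ⟨a', b', h', inf_le_left.trans ha, hb.trans (le_of_eq ?_)⟩
      rw [Finset.insert_sdiff_of_notMem _ fun h => hk (hX h), Finset.sup_insert]
      ac_rfl
    -- The subsets that contain `k` have `u k` on the left-hand side. Distributivity replaces it by
    -- `a ⊓ u k`, which by `h2` may be added to `a₀`.
    refine ih' (a₀ := a₀ ⊔ a ⊓ u k) (b₀ := b₀) (sup_le h₀ h2) h₁ ?_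
    intro X hX
    obtain ⟨a', b', h', ha, hb⟩ := h (insert k X) (Finset.insert_subset_insert k hX)
    refine ⟨a', b', h', ?_, hb.trans (sup_le_sup_left (Finset.sup_mono ?_) _)⟩
    · rw [Finset.sup_insert] at ha
      calc a ≤ a ⊓ ((a₀ ⊔ a' ⊔ X.sup u) ⊔ u k) := le_inf le_rfl (ha.trans (le_of_eq (by ac_rfl)))
        _ ≤ a ⊓ (a₀ ⊔ a' ⊔ X.sup u) ⊔ a ⊓ u k := hD _ _ _
        _ ≤ (a₀ ⊔ a' ⊔ X.sup u) ⊔ a ⊓ u k := sup_le_sup_right inf_le_right _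
        _ = a₀ ⊔ a ⊓ u k ⊔ a' ⊔ X.sup u := by ac_rfl
    · intro i hi
      simp only [Finset.mem_sdiff, Finset.mem_insert, not_or] at hi ⊢
      tauto

/-- If, however a finite family of pairs in `I` is split in two, `(α, β)` is bounded by a pair in
`I` and the two parts of the family, then `(α, β)` is in `I`. -/
theorem mem_of_forall_subset (I : BiIdeal (ConC A) T) {ι : Type*} [DecidableEq ι] (J : Finset ι)
    {u : ι → ConC A} {v : ι → T} (hJ : ∀ i ∈ J, (u i, v i) ∈ I.carrier) {α : ConC A} {t : T}
    (h : ∀ X ⊆ J, ∃ α' t', (α', t') ∈ I.carrier ∧ α ≤ α' ⊔ X.sup u ∧ t ≤ t' ⊔ (J \ X).sup v) :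
    (α, t) ∈ I.carrier := by
  rw [← le_leftCon_iff]
  refine cut LatticeCon.inf_sup_le (fun _ _ => I.leftCon_anti) I.inf_leftCon_le J
    (u := fun i => (u i).1) (v := v) (fun i hi => le_leftCon_iff.2 (hJ i hi)) t
    (a₀ := ⊥) (b₀ := ⊥) bot_le (le_leftCon_iff.2 (I.right_bot_mem α)) fun X hX => ?_
  obtain ⟨α', t', h', h1, h2⟩ := h X hX
  refine ⟨α'.1, t', le_leftCon_iff.2 h', ?_, by rwa [bot_sup_eq]⟩
  rw [bot_sup_eq]
  have hX : (X.sup u).1 = X.sup fun i => (u i).1 :=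
    Finset.apply_sup_eq_sup_comp Subtype.val (fun _ _ => rfl) rfl
  rw [← hX]
  exact h1

end BiIdeal

/-- The meet of `a` with finitely many witnesses is a common witness, because `θ.Le a` is closed
under meets and each `P i` passes downwards. -/
theorem LatticeCon.Le.exists_forall {L ι : Type*} [Lattice L] {θ : LatticeCon L} {a : L}
    {P : ι → L → Prop} (anti : ∀ i ⦃x y⦄, x ≤ y → P i y → P i x) (s : Finset ι)
    (h : ∀ i ∈ s, ∃ x, θ.Le a x ∧ P i x) : ∃ x ≤ a, θ.Le a x ∧ ∀ i ∈ s, P i x := by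
  classical
  induction s using Finset.induction_on with
  | empty => exact ⟨a, le_rfl, .of_le le_rfl, by simp⟩
  | insert k s _ ih =>
    obtain ⟨x, hxa, hx, hs⟩ := ih fun i hi => h i (Finset.mem_insert_of_mem hi)
    obtain ⟨y, hy, hk⟩ := h k (Finset.mem_insert_self k s)
    refine ⟨x ⊓ y, inf_le_left.trans hxa, hx.inf hy, fun i hi => ?_⟩
    rcases Finset.mem_insert.1 hi with rfl | hi
    · exact anti _ inf_le_right hk
    · exact anti _ inf_le_left (hs i hi)

/-! ### Elements of the lattice tensor product -/

namespace LatticeTensor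

variable {A B : Type*} [Lattice A] [OrderBot A] [Lattice B] [OrderBot B]
  {H K : LatticeTensor A B} {a a' x : A} {b b' y : B}

theorem exists_boxes (H : LatticeTensor A B) :
    ∃ s : Finset (A × B), ∀ p, p ∈ H.1 ↔ ∀ q ∈ s, p ∈ pureBox q.1 q.2 := by
  obtain ⟨s, -, h⟩ := H.2.1
  exact ⟨s, fun p => by rw [h, Set.mem_iInter₂]⟩

theorem mem_mono (h : (a, b) ∈ H.1) (hx : x ≤ a) (hy : y ≤ b) : (x, y) ∈ H.1 := by
  obtain ⟨s, hs⟩ := H.exists_boxes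
  rw [hs] at h ⊢
  exact fun q hq => (h q hq).imp hx.trans hy.trans

theorem bot_left_mem (b : B) : ((⊥ : A), b) ∈ H.1 := by
  obtain ⟨s, hs⟩ := H.exists_boxes
  exact (hs _).2 fun _ _ => Or.inl bot_le

theorem bot_right_mem (a : A) : (a, (⊥ : B)) ∈ H.1 := by
  obtain ⟨s, hs⟩ := H.exists_boxes
  exact (hs _).2 fun _ _ => Or.inr bot_le

theorem sup_left_mem (h : (a, b) ∈ H.1) (k : (a', b) ∈ H.1) : (a ⊔ a', b) ∈ H.1 := by
  obtain ⟨s, hs⟩ := H.exists_boxes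
  rw [hs] at h k ⊢
  intro q hq
  rcases h q hq with h | h
  · exact (k q hq).imp (sup_le h) id
  · exact Or.inr h

theorem sup_right_mem (h : (a, b) ∈ H.1) (k : (a, b') ∈ H.1) : (a, b ⊔ b') ∈ H.1 := by
  obtain ⟨s, hs⟩ := H.exists_boxes
  rw [hs] at h k ⊢
  intro q hq
  rcases h q hq with h | h
  · exact Or.inl h
  · exact (k q hq).imp id (sup_le h)

theorem tmul_le_iff : tmul a b ≤ H ↔ (a, b) ∈ H.1 := by
  constructor
  · exact fun h => h (Or.inl ⟨le_rfl, le_rfl⟩)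
  · rintro h ⟨x, y⟩ (⟨hx, hy⟩ | hx | hy)
    · exact mem_mono h hx hy
    · obtain rfl : x = ⊥ := hx
      exact bot_left_mem y
    · obtain rfl : y = ⊥ := hy
      exact bot_right_mem x

theorem tmul_mono (ha : a ≤ a') (hb : b ≤ b') : tmul a b ≤ tmul a' b' :=
  tmul_le_iff.2 (Or.inl ⟨ha, hb⟩)

theorem tmul_subset_pureBox : (tmul a b).1 ⊆ pureBox a' b' ↔ a ≤ a' ∨ b ≤ b' :=
  pureLatticeTensor_subset_pureBox

theorem sup_subset_pureBox :
    (H ⊔ K).1 ⊆ pureBox a b ↔ H.1 ⊆ pureBox a b ∧ K.1 ⊆ pureBox a b := by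
  constructor
  · exact fun h => ⟨fun _ hp => h ((le_sup_left : H ≤ H ⊔ K) hp),
      fun _ hp => h ((le_sup_right : K ≤ H ⊔ K) hp)⟩
  · exact fun h p hp => hp a b (Set.union_subset h.1 h.2)

/-- The cases `q.1 = ⊥` and `q.2 = ⊥` account for the axes, which belong to every pure tensor
without lying below its corner. -/
theorem exists_tensors (H : LatticeTensor A B) :
    ∃ t : Finset (A × B), (∀ p ∈ t, p ∈ H.1) ∧
      ∀ p ∈ H.1, ∃ q, (q ∈ t ∨ q.1 = ⊥ ∨ q.2 = ⊥) ∧ p.1 ≤ q.1 ∧ p.2 ≤ q.2 := by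
  obtain ⟨t, ht⟩ := exists_eq_biUnion H.2.1 H.2.2
  refine ⟨t, fun p hp => ?_, fun p hp => ?_⟩
  · rw [ht]
    exact Set.mem_iUnion₂.2 ⟨p, hp, Or.inl ⟨le_rfl, le_rfl⟩⟩
  · rw [ht] at hp
    obtain ⟨q, hq, h | h⟩ := Set.mem_iUnion₂.1 hp
    · exact ⟨q, Or.inl hq, h⟩
    · exact ⟨p, Or.inr h, le_rfl, le_rfl⟩

theorem le_of_subset_pureBox (h : K ≤ tmul a b) (hK : K.1 ⊆ pureBox a' b') :
    K ≤ tmul (a ⊓ a') b ⊔ tmul a (b ⊓ b') := by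
  rintro ⟨x, y⟩ hp
  have h0 : ∀ M : LatticeTensor A B, x = ⊥ ∨ y = ⊥ → (x, y) ∈ M.1 := by
    rintro M (rfl | rfl)
    · exact bot_left_mem y
    · exact bot_right_mem x
  rcases h hp with ⟨hx, hy⟩ | h
  · rcases hK hp with hx' | hy'
    · exact (le_sup_left : tmul (a ⊓ a') b ≤ _) (Or.inl ⟨le_inf hx hx', hy⟩)
    · exact (le_sup_right : tmul a (b ⊓ b') ≤ _) (Or.inl ⟨hx, le_inf hy hy'⟩)
  · exact h0 _ h

/-! ### Congruences of the lattice tensor product -/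

/-- `a ⊠ b` is contained in `a' □ b'` modulo the congruence `Θ`. -/
def LeBox (Θ : LatticeCon (LatticeTensor A B)) (a a' : A) (b b' : B) : Prop :=
  ∃ K : LatticeTensor A B, Θ.Le (tmul a b) K ∧ K.1 ⊆ pureBox a' b'

variable {Θ Ψ : LatticeCon (LatticeTensor A B)}

/-- A pure box need not be confined, so it may fail to be an element of A ⊠ B; this is why `LeBox`
asks for a witness `K` inside it. After meeting with a ⊠ b there is a largest possible witness,
namely the join on the right. -/
theorem leBox_iff : LeBox Θ a a' b b' ↔
    Θ.Le (tmul a b) (tmul (a ⊓ a') b ⊔ tmul a (b ⊓ b')) := by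
  constructor
  · rintro ⟨K, h, hK⟩
    exact ((LatticeCon.Le.of_le le_rfl).inf h).trans
      (.of_le (le_of_subset_pureBox inf_le_left fun p hp => hK hp.2))
  · refine fun h => ⟨_, h, sup_subset_pureBox.2 ⟨?_, ?_⟩⟩
    · exact tmul_subset_pureBox.2 (Or.inl inf_le_right)
    · exact tmul_subset_pureBox.2 (Or.inr inf_le_right)

/-- A congruence of `A ⊠ B` is determined by the relation `LeBox`. -/
theorem le_iff_forall_leBox : Θ.Le H K ↔
    ∀ a b, (a, b) ∈ H.1 → ∀ a' b', K.1 ⊆ pureBox a' b' → LeBox Θ a a' b b' := by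
  constructor
  · exact fun h a b hab a' b' hK => ⟨K, (LatticeCon.Le.of_le (tmul_le_iff.2 hab)).trans h, hK⟩
  · intro h
    obtain ⟨t, htH, hHt⟩ := H.exists_tensors
    obtain ⟨s, hs⟩ := K.exists_boxes
    have hH : H ≤ t.sup fun q => tmul q.1 q.2 := by
      rintro ⟨x, y⟩ hp
      obtain ⟨⟨u, v⟩, hq | rfl | rfl, h1, h2⟩ := hHt _ hp
      · exact tmul_le_iff.1 ((Finset.le_sup (f := fun q : A × B => tmul q.1 q.2) hq).trans'
          (tmul_le_iff.2 (Or.inl ⟨h1, h2⟩)))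
      · exact mem_mono (bot_left_mem v) h1 h2
      · exact mem_mono (bot_right_mem u) h1 h2
    refine (LatticeCon.Le.of_le hH).trans ?_
    refine Finset.sup_induction (p := fun x => Θ.Le x K) (.of_le bot_le)
      (fun _ hx _ hy => hx.sup hy) fun q hq => ?_
    -- For each of the finitely many boxes cutting out `K` there is a separate witness; their meet
    -- `N` lies in all the boxes, hence in `K`.
    obtain ⟨N, -, hN, hNs⟩ := LatticeCon.Le.exists_forall (θ := Θ) (a := tmul q.1 q.2)
      (P := fun (r : A × B) N => N.1 ⊆ pureBox r.1 r.2) (fun _ _ _ h k => Set.Subset.trans h k) s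
      fun r hr => h q.1 q.2 (htH q hq) r.1 r.2 fun p hp => (hs p).1 hp r hr
    exact hN.trans (.of_le fun p hp => (hs p).2 fun r hr => hNs r hr hp)

theorem LeBox.of_le_left (h : a ≤ a') : LeBox Θ a a' b b' :=
  ⟨_, .of_le le_rfl, tmul_subset_pureBox.2 (Or.inl h)⟩

theorem LeBox.of_le_right (h : b ≤ b') : LeBox Θ a a' b b' :=
  ⟨_, .of_le le_rfl, tmul_subset_pureBox.2 (Or.inr h)⟩

/-- The congruence of `A` given by `LeBox`, for fixed elements of `B`. -/
def leBoxLeft (Θ : LatticeCon (LatticeTensor A B)) (b b' : B) : LatticeCon A :=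
  .ofPreorder (fun a a' => LeBox Θ a a' b b') (fun _ _ => .of_le_left)
    -- In the canonical bound for x ⊠ b, the summand (x ⊓ y) ⊠ b lies below y ⊠ b and so moves on to
    -- `K`; the other summand is already in every box with second entry `b'`.
    (fun x y z h ⟨K, hK, hKz⟩ => by
      refine ⟨K ⊔ tmul x (b ⊓ b'), (leBox_iff.1 h).trans (.sup ?_ (.of_le le_sup_right)),
        sup_subset_pureBox.2 ⟨hKz, tmul_subset_pureBox.2 (Or.inr inf_le_right)⟩⟩
      exact (LatticeCon.Le.of_le (tmul_mono inf_le_right le_rfl)).trans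
        (hK.trans (.of_le le_sup_left)))
    (fun x y z ⟨K, hK, hKz⟩ ⟨M, hM, hMz⟩ => by
      refine ⟨K ⊔ M, LatticeCon.Le.trans (.of_le ?_)
        ((hK.trans (.of_le le_sup_left)).sup (hM.trans (.of_le le_sup_right))),
        sup_subset_pureBox.2 ⟨hKz, hMz⟩⟩
      exact tmul_le_iff.2 (sup_left_mem (tmul_le_iff.1 le_sup_left) (tmul_le_iff.1 le_sup_right)))
    (fun x y z ⟨K, hK, hKz⟩ ⟨M, hM, hMz⟩ => by
      refine ⟨K ⊓ M, hK.inf hM, fun p hp => ?_⟩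
      rcases hKz hp.1 with h | h
      · exact (hMz hp.2).imp (le_inf h) id
      · exact Or.inr h)

/-- The congruence of `B` given by `LeBox`, for fixed elements of `A`. -/
def leBoxRight (Θ : LatticeCon (LatticeTensor A B)) (a a' : A) : LatticeCon B :=
  .ofPreorder (fun b b' => LeBox Θ a a' b b') (fun _ _ => .of_le_right)
    (fun x y z h ⟨K, hK, hKz⟩ => by
      refine ⟨tmul (a ⊓ a') x ⊔ K, (leBox_iff.1 h).trans (.sup (.of_le le_sup_left) ?_),
        sup_subset_pureBox.2 ⟨tmul_subset_pureBox.2 (Or.inl inf_le_right), hKz⟩⟩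
      exact (LatticeCon.Le.of_le (tmul_mono le_rfl inf_le_right)).trans
        (hK.trans (.of_le le_sup_right)))
    (fun x y z ⟨K, hK, hKz⟩ ⟨M, hM, hMz⟩ => by
      refine ⟨K ⊔ M, LatticeCon.Le.trans (.of_le ?_)
        ((hK.trans (.of_le le_sup_left)).sup (hM.trans (.of_le le_sup_right))),
        sup_subset_pureBox.2 ⟨hKz, hMz⟩⟩
      exact tmul_le_iff.2 (sup_right_mem (tmul_le_iff.1 le_sup_left) (tmul_le_iff.1 le_sup_right)))
    (fun x y z ⟨K, hK, hKz⟩ ⟨M, hM, hMz⟩ => by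
      refine ⟨K ⊓ M, hK.inf hM, fun p hp => ?_⟩
      rcases hKz hp.1 with h | h
      · exact Or.inl h
      · exact (hMz hp.2).imp id (le_inf h))

theorem leBoxLeft_le : (leBoxLeft Θ b b').Le a a' ↔ LeBox Θ a a' b b' :=
  LatticeCon.ofPreorder_le ..

theorem leBoxRight_le : (leBoxRight Θ a a').Le b b' ↔ LeBox Θ a a' b b' :=
  LatticeCon.ofPreorder_le ..

/-- The bi-ideal of all pairs of compact congruences whose tensor is contained in `Θ`. -/
def biIdeal (Θ : LatticeCon (LatticeTensor A B)) : BiIdeal (ConC A) (ConC B) where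
  carrier := {p | ∀ a a', p.1.1.Le a a' → ∀ b b', p.2.1.Le b b' → LeBox Θ a a' b b'}
  right_bot_mem α a a' _ b b' hb := leBoxRight_le.1 (hb.mono bot_le)
  left_bot_mem β a a' ha b b' _ := leBoxLeft_le.1 (ha.mono bot_le)
  hereditary p q hqp hp a a' ha b b' hb := hp a a' (ha.mono hqp.1) b b' (hb.mono hqp.2)
  left_sup_mem α α' β h k a a' ha b b' hb := by
    have hα : ∀ α : ConC A, (∀ a a', α.1.Le a a' → ∀ b b', β.1.Le b b' → LeBox Θ a a' b b') →
        α.1 ≤ leBoxLeft Θ b b' := fun α h =>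
      LatticeCon.le_of_forall_le fun a a' ha => leBoxLeft_le.2 (h a a' ha b b' hb)
    exact leBoxLeft_le.1 (ha.mono (sup_le (hα α h) (hα α' k)))
  right_sup_mem α β β' h k a a' ha b b' hb := by
    have hβ : ∀ β : ConC B, (∀ a a', α.1.Le a a' → ∀ b b', β.1.Le b b' → LeBox Θ a a' b b') →
        β.1 ≤ leBoxRight Θ a a' := fun β h =>
      LatticeCon.le_of_forall_le fun b b' hb => leBoxRight_le.2 (h a a' ha b b' hb)
    exact leBoxRight_le.1 (hb.mono (sup_le (hβ β h) (hβ β' k)))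

/-- `LeBox` is the preorder of a congruence in each variable separately. One instance therefore
spreads to all pairs ordered by the generated principal congruences, first in A and then in B. -/
theorem principalLe_mem_biIdeal :
    (ConC.principalLe a a', ConC.principalLe b b') ∈ (biIdeal Θ).carrier ↔
      LeBox Θ a a' b b' := by
  constructor
  · exact fun h => h _ _ (ConC.le_principalLe a a') _ _ (ConC.le_principalLe b b')
  · intro h x x' hx y y' hy
    have h1 : (ConC.principalLe a a').1 ≤ leBoxLeft Θ b b' :=
      ConC.principalLe_val_le_iff.2 (leBoxLeft_le.2 h)
    have h2 : (ConC.principalLe b b').1 ≤ leBoxRight Θ x x' :=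
      ConC.principalLe_val_le_iff.2 (leBoxRight_le.2 (leBoxLeft_le.1 (hx.mono h1)))
    exact leBoxRight_le.1 (hy.mono h2)

theorem biIdeal_le_biIdeal_iff : biIdeal Θ ≤ biIdeal Ψ ↔ Θ ≤ Ψ := by
  constructor
  · refine fun h => LatticeCon.le_of_forall_le fun H K hHK => ?_
    rw [le_iff_forall_leBox] at hHK ⊢
    exact fun a b hab a' b' hK =>
      principalLe_mem_biIdeal.1 (h (principalLe_mem_biIdeal.2 (hHK a b hab a' b' hK)))
  · rintro h p hp a a' ha b b' hb
    obtain ⟨K, hK, hK'⟩ := hp a a' ha b b' hb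
    exact ⟨K, hK.mono h, hK'⟩

/-! ### From bi-ideals to congruences of A ⊠ B. -/

/-- `H` is contained in `K` modulo the bi-ideal `I`. -/
def LeMod (I : BiIdeal (ConC A) (ConC B)) (H K : LatticeTensor A B) : Prop :=
  ∀ a b, (a, b) ∈ H.1 → ∀ a' b', K.1 ⊆ pureBox a' b' →
    (ConC.principalLe a a', ConC.principalLe b b') ∈ I.carrier

theorem le_sup_of_le_right {L ι : Type*} [Lattice L] [OrderBot L] {θ : LatticeCon L}
    {s : Finset ι} {u : ι → L} {c : L} (h : ∀ i ∈ s, θ.Le (u i) c) : θ.Le (s.sup u) c :=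
  Finset.sup_induction (p := fun x => θ.Le x c) (.of_le bot_le) (fun _ hx _ hy => hx.sup hy) h

variable {I : BiIdeal (ConC A) (ConC B)} {M : LatticeTensor A B}

theorem LeMod.of_le (h : H ≤ K) : LeMod I H K := by
  intro a b hab a' b' hK
  rcases hK (h hab) with h | h
  · rw [ConC.principalLe_of_le h]
    exact I.left_bot_mem _
  · rw [ConC.principalLe_of_le h]
    exact I.right_bot_mem _

theorem le_sup_principalLe {L ι : Type*} [Lattice L] {X : Finset ι} {i : ι} (hi : i ∈ X)
    (u v : ι → L) {α : ConC L} :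
    (α ⊔ X.sup fun i => ConC.principalLe (u i) (v i)).1.Le (u i) (v i) :=
  ConC.principalLe_le_iff.1 ((Finset.le_sup (f := fun i => ConC.principalLe (u i) (v i))
    hi).trans le_sup_right)

/-- Let the cut rule run over the tensors making up `H` and `K`. For each split of this family, `H ⊔
K` lies in the box formed by the join of the first coordinates over one part and of the second
coordinates over the other. So `a` or `b` is bounded by the corresponding join. -/
theorem LeMod.sup (h : LeMod I H M) (k : LeMod I K M) : LeMod I (H ⊔ K) M := by
  classical
  intro a b hab a' b' hM
  obtain ⟨t, ht, hHt⟩ := H.exists_tensors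
  obtain ⟨s, hs, hKs⟩ := K.exists_tensors
  refine I.mem_of_forall_subset (t ∪ s) (u := fun q => ConC.principalLe q.1 a')
    (v := fun q => ConC.principalLe q.2 b') ?_ fun X _ => ?_
  · intro q hq
    rcases Finset.mem_union.1 hq with hq | hq
    · exact h _ _ (ht q hq) _ _ hM
    · exact k _ _ (hs q hq) _ _ hM
  have hHK : ∀ N : LatticeTensor A B, ∀ r : Finset (A × B), r ⊆ t ∪ s →
      (∀ p ∈ N.1, ∃ q, (q ∈ r ∨ q.1 = ⊥ ∨ q.2 = ⊥) ∧ p.1 ≤ q.1 ∧ p.2 ≤ q.2) →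
      N.1 ⊆ pureBox (X.sup Prod.fst) (((t ∪ s) \ X).sup Prod.snd) := by
    rintro N r hr hN p hp
    obtain ⟨q, hq | hq | hq, h1, h2⟩ := hN p hp
    · by_cases hqX : q ∈ X
      · exact Or.inl (h1.trans (Finset.le_sup (f := Prod.fst) hqX))
      · exact Or.inr (h2.trans (Finset.le_sup (f := Prod.snd)
          (Finset.mem_sdiff.2 ⟨hr hq, hqX⟩)))
    · exact Or.inl (h1.trans (hq.le.trans bot_le))
    · exact Or.inr (h2.trans (hq.le.trans bot_le))
  have hab' := sup_subset_pureBox.2 ⟨hHK H t Finset.subset_union_left hHt,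
    hHK K s Finset.subset_union_right hKs⟩ hab
  rcases hab' with hX | hX
  -- A pair with `⊥` in one coordinate is always in `I`, so the condition on the other coordinate
  -- can be made trivial.
  · refine ⟨⊥, _, I.left_bot_mem (ConC.principalLe b b'), ?_, le_sup_left⟩
    refine ConC.principalLe_le_iff.2 (LatticeCon.Le.trans (.of_le hX) (le_sup_of_le_right ?_))
    exact fun q hq => le_sup_principalLe hq Prod.fst fun _ => a'
  · refine ⟨_, ⊥, I.right_bot_mem (ConC.principalLe a a'), le_sup_left, ?_⟩
    refine ConC.principalLe_le_iff.2 (LatticeCon.Le.trans (.of_le hX) (le_sup_of_le_right ?_))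
    exact fun q hq => le_sup_principalLe hq Prod.snd fun _ => b'

/-- A finite family of boxes is met by lowering one coordinate or the other. -/
theorem exists_mem_boxes {A B : Type*} [Lattice A] [Lattice B] {a : A} {b : B} {X J : Finset (A × B)} {α : LatticeCon A} {β : LatticeCon B}
    [DecidableEq (A × B)]
    (hα : ∀ q ∈ X, α.Le a q.1) (hβ : ∀ q ∈ J \ X, β.Le b q.2) :
    ∃ x ≤ a, ∃ y ≤ b, α.Le a x ∧ β.Le b y ∧ ∀ q ∈ J, (x, y) ∈ pureBox q.1 q.2 := by
  obtain ⟨x, hxa, hx, hxX⟩ := LatticeCon.Le.exists_forall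
    (P := fun (q : A × B) x => x ≤ q.1) (fun _ _ _ h k => h.trans k) X
    fun q hq => ⟨q.1, hα q hq, le_rfl⟩
  obtain ⟨y, hyb, hy, hyX⟩ := LatticeCon.Le.exists_forall
    (P := fun (q : A × B) y => y ≤ q.2) (fun _ _ _ h k => h.trans k) (J \ X)
    fun q hq => ⟨q.2, hβ q hq, le_rfl⟩
  refine ⟨x, hxa, y, hyb, hx, hy, fun q hq => ?_⟩
  by_cases hqX : q ∈ X
  · exact Or.inl (hxX q hqX)
  · exact Or.inr (hyX q (Finset.mem_sdiff.2 ⟨hq, hqX⟩))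

/-- Now the cut rule runs over the boxes that cut out `K` and `M`. For each split, `(a, b)` can be
lowered, modulo the joins of the two parts, to a point of `K ⊓ M`, which lies in the target box. -/
theorem LeMod.inf (h : LeMod I H K) (k : LeMod I H M) : LeMod I H (K ⊓ M) := by
  classical
  intro a b hab a' b' hM
  obtain ⟨t, ht⟩ := K.exists_boxes
  obtain ⟨s, hs⟩ := M.exists_boxes
  refine I.mem_of_forall_subset (t ∪ s) (u := fun q => ConC.principalLe a q.1)
    (v := fun q => ConC.principalLe b q.2) ?_ fun X _ => ?_
  · intro q hq
    rcases Finset.mem_union.1 hq with hq | hq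
    · exact h _ _ hab _ _ fun p hp => (ht p).1 hp q hq
    · exact k _ _ hab _ _ fun p hp => (hs p).1 hp q hq
  obtain ⟨x, -, y, -, hx, hy, hxy⟩ := exists_mem_boxes
    (fun q hq => le_sup_principalLe (α := ⊥) hq (fun _ => a) Prod.fst)
    (fun q hq => le_sup_principalLe (α := ⊥) hq (fun _ => b) Prod.snd)
  rcases hM (show (x, y) ∈ (K ⊓ M).1 from
    ⟨(ht _).2 fun q hq => hxy q (Finset.mem_union_left s hq),
      (hs _).2 fun q hq => hxy q (Finset.mem_union_right t hq)⟩) with hX | hX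
  · exact ⟨⊥, _, I.left_bot_mem (ConC.principalLe b b'),
      ConC.principalLe_le_iff.2 (hx.trans (.of_le hX)), le_sup_left⟩
  · exact ⟨_, ⊥, I.right_bot_mem (ConC.principalLe a a'), le_sup_left,
      ConC.principalLe_le_iff.2 (hy.trans (.of_le hX))⟩

/-- The lowered point `(x, y)` lies in `K` only, so `k` must be applied to it. The pair this yields
in `I` is the extra pair `(α', t')` that the cut rule allows for each split. -/
theorem LeMod.trans (h : LeMod I H K) (k : LeMod I K M) : LeMod I H M := by
  classical
  intro a b hab a' b' hM
  obtain ⟨t, ht⟩ := K.exists_boxes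
  refine I.mem_of_forall_subset t (u := fun q => ConC.principalLe a q.1)
    (v := fun q => ConC.principalLe b q.2)
    (fun q hq => h _ _ hab _ _ fun p hp => (ht p).1 hp q hq) fun X _ => ?_
  obtain ⟨x, -, y, -, hx, hy, hxy⟩ := exists_mem_boxes
    (fun q hq => le_sup_principalLe (α := ⊥) hq (fun _ => a) Prod.fst)
    (fun q hq => le_sup_principalLe (α := ⊥) hq (fun _ => b) Prod.snd)
  rw [bot_sup_eq] at hx hy
  refine ⟨_, _, k x y ((ht _).2 hxy) a' b' hM, ?_, ?_⟩
  · exact ConC.principalLe_le_iff.2 ((hx.mono (le_sup_right (α := ConC A))).trans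
      ((ConC.le_principalLe x a').mono (le_sup_left (α := ConC A))))
  · exact ConC.principalLe_le_iff.2 ((hy.mono (le_sup_right (α := ConC B))).trans
      ((ConC.le_principalLe y b').mono (le_sup_left (α := ConC B))))

/-- The congruence of `A ⊠ B` generated by a bi-ideal. -/
def ofBiIdeal (I : BiIdeal (ConC A) (ConC B)) : LatticeCon (LatticeTensor A B) :=
  .ofPreorder (LeMod I) (fun _ _ => .of_le) (fun _ _ _ => .trans) (fun _ _ _ => .sup)
    fun _ _ _ => .inf

theorem ofBiIdeal_le : (ofBiIdeal I).Le H K ↔ LeMod I H K :=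
  LatticeCon.ofPreorder_le ..

/-- Passing from `I` to a congruence creates no new pairs and loses none. For the second claim take
the canonical witness of `leBox_iff` and a box c □ d around it: the only nontrivial case is `a ⊓ a'
≤ c` and `b ⊓ b' ≤ d`, where forcing `a ≤ a'` forces `a ≤ c`, and likewise in B. -/
theorem leBox_ofBiIdeal :
    LeBox (ofBiIdeal I) a a' b b' ↔
      (ConC.principalLe a a', ConC.principalLe b b') ∈ I.carrier := by
  constructor
  · rintro ⟨K, h, hK⟩
    exact ofBiIdeal_le.1 h a b (Or.inl ⟨le_rfl, le_rfl⟩) a' b' hK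
  · rw [leBox_iff, ofBiIdeal_le]
    intro h x y hxy c d hN
    obtain ⟨h1, h2⟩ := sup_subset_pureBox.1 hN
    rw [tmul_subset_pureBox] at h1 h2
    have hl : x ≤ c → (ConC.principalLe x c, ConC.principalLe y d) ∈ I.carrier := fun h => by
      rw [ConC.principalLe_of_le h]
      exact I.left_bot_mem _
    have hr : y ≤ d → (ConC.principalLe x c, ConC.principalLe y d) ∈ I.carrier := fun h => by
      rw [ConC.principalLe_of_le h]
      exact I.right_bot_mem _
    rcases hxy with ⟨hx, hy⟩ | hx | hy
    · rcases h1 with h1 | h1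
      · rcases h2 with h2 | h2
        · exact hl (hx.trans h2)
        · refine I.hereditary (Prod.mk_le_mk.2 ⟨?_, ?_⟩) h
          · exact ConC.principalLe_le_iff.2 (LatticeCon.Le.trans (.of_le hx)
              (LatticeCon.Le.trans ((LatticeCon.Le.of_le le_rfl).inf (ConC.le_principalLe a a'))
                (.of_le h1)))
          · exact ConC.principalLe_le_iff.2 (LatticeCon.Le.trans (.of_le hy)
              (LatticeCon.Le.trans ((LatticeCon.Le.of_le le_rfl).inf (ConC.le_principalLe b b'))
                (.of_le h2)))
      · exact hr (hy.trans h1)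
    · exact hl (hx.le.trans bot_le)
    · exact hr (hy.le.trans bot_le)

/-- By `leBox_ofBiIdeal` both sides contain the same pairs of principal congruences. These determine
a bi-ideal, since compact congruences are finite joins of principal ones. -/
theorem biIdeal_ofBiIdeal (I : BiIdeal (ConC A) (ConC B)) : biIdeal (ofBiIdeal I) = I := by
  apply le_antisymm
  · rintro ⟨α, β⟩ h
    replace h : ∀ a a', ConC.principalLe a a' ≤ α → ∀ b b', ConC.principalLe b b' ≤ β →
        (ConC.principalLe a a', ConC.principalLe b b') ∈ I.carrier := fun a a' ha b b' hb =>
      leBox_ofBiIdeal.1 (h a a' (ConC.principalLe_le_iff.1 ha) b b' (ConC.principalLe_le_iff.1 hb))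
    induction α using ConC.induction generalizing β with
    | bot => exact I.left_bot_mem β
    | principalLe a a' =>
      replace h := h a a' le_rfl
      induction β using ConC.induction with
      | bot => exact I.right_bot_mem _
      | principalLe b b' => exact h b b' le_rfl
      | sup β β' ih ih' =>
        exact I.right_sup_mem (ih fun b b' hb => h b b' (hb.trans le_sup_left))
          (ih' fun b b' hb => h b b' (hb.trans le_sup_right))
    | sup α α' ih ih' =>
      exact I.left_sup_mem (ih β fun a a' ha => h a a' (ha.trans le_sup_left))
        (ih' β fun a a' ha => h a a' (ha.trans le_sup_right))
  · rintro ⟨α, β⟩ h a a' ha b b' hb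
    exact leBox_ofBiIdeal.2 (I.hereditary (Prod.mk_le_mk.2
      ⟨ConC.principalLe_le_iff.2 ha, ConC.principalLe_le_iff.2 hb⟩) h)

/-! ### The isomorphism and its value on principal congruences. -/

/-- The congruence lattice of `A ⊠ B` is the lattice of bi-ideals of `Con_c A × Con_c B`. -/
def conOrderIso (A B : Type*) [Lattice A] [OrderBot A] [Lattice B] [OrderBot B] :
    LatticeCon (LatticeTensor A B) ≃o BiIdeal (ConC A) (ConC B) where
  toFun := biIdeal
  invFun := ofBiIdeal
  left_inv _ := le_antisymm (biIdeal_le_biIdeal_iff.1 (biIdeal_ofBiIdeal _).le)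
    (biIdeal_le_biIdeal_iff.1 (biIdeal_ofBiIdeal _).ge)
  right_inv := biIdeal_ofBiIdeal
  map_rel_iff' := biIdeal_le_biIdeal_iff

/-- Both sides are compared with an arbitrary bi-ideal, which comes from some `Θ`. The displayed
join is the canonical witness of `leBox_iff` for a₁ ⊠ b₁ and the box a₀ □ b₀, since the meets reduce
to `a₀` and `b₀`. -/
theorem conOrderIso_principal {a₀ a₁ : A} (ha : a₀ ≤ a₁) {b₀ b₁ : B} (hb : b₀ ≤ b₁) :
    conOrderIso A B (LatticeCon.principal (tmul a₀ b₁ ⊔ tmul a₁ b₀) (tmul a₁ b₁)) =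
      BiIdeal.pure (ConC.principal a₀ a₁) (ConC.principal b₀ b₁) := by
  refine eq_of_forall_ge_iff fun I => ?_
  obtain ⟨Θ, rfl⟩ := (conOrderIso A B).surjective I
  have h : tmul a₀ b₁ ⊔ tmul a₁ b₀ ≤ tmul a₁ b₁ :=
    sup_le (tmul_mono ha le_rfl) (tmul_mono le_rfl hb)
  rw [(conOrderIso A B).le_iff_le, BiIdeal.pure_le_iff, ConC.principal_eq_principalLe ha,
    ConC.principal_eq_principalLe hb]
  refine Iff.trans ?_ principalLe_mem_biIdeal.symm
  rw [leBox_iff, inf_eq_right.2 ha, inf_eq_right.2 hb, LatticeCon.principal_le_iff,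
    LatticeCon.Le, inf_eq_right.2 h]

end LatticeTensor

/-! ### Transfer to S ⊗ T, and uniqueness. -/

namespace SemilatticeTensor

variable {S T : Type*} [SemilatticeSup S] [OrderBot S] [SemilatticeSup T] [OrderBot T]
  {A B : Type*} [Lattice A] [OrderBot A] [Lattice B] [OrderBot B]

/-- The isomorphism of `S ⊗ T` onto `Con_c (A ⊠ B)` for `Con_c A ≅ S` and `Con_c B ≅ T`. -/
def isoConC (f : ConC A ≃o S) (g : ConC B ≃o T) :
    SemilatticeTensor S T ≃o ConC (LatticeTensor A B) :=
  ((LatticeTensor.conOrderIso A B).trans (BiIdeal.congr f g)).compacts.symm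

theorem isoConC_tmul (f : ConC A ≃o S) (g : ConC B ≃o T) {a₀ a₁ : A} (ha : a₀ ≤ a₁)
    {b₀ b₁ : B} (hb : b₀ ≤ b₁) :
    isoConC f g (tmul (f (ConC.principal a₀ a₁)) (g (ConC.principal b₀ b₁))) =
      ConC.principal (LatticeTensor.tmul a₀ b₁ ⊔ LatticeTensor.tmul a₁ b₀)
        (LatticeTensor.tmul a₁ b₁) := by
  rw [isoConC, OrderIso.symm_apply_eq]
  apply Subtype.ext
  change BiIdeal.pure _ _ = BiIdeal.congr f g (LatticeTensor.conOrderIso A B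
    (LatticeCon.principal _ _))
  rw [LatticeTensor.conOrderIso_principal ha hb]
  ext ⟨s, t⟩
  change (s ≤ _ ∧ t ≤ _ ∨ s = ⊥ ∨ t = ⊥) ↔
    (f.symm s ≤ _ ∧ g.symm t ≤ _ ∨ f.symm s = ⊥ ∨ g.symm t = ⊥)
  rw [f.symm_apply_le, g.symm_apply_le, map_eq_bot_iff, map_eq_bot_iff]

/-- Order isomorphisms preserve finite joins and `tmul` preserves them in each coordinate, so
agreement spreads from principal congruences to all compact ones, and from pure tensors to all of S
⊗ T. -/
theorem orderIso_ext {A B U : Type*} [Lattice A] [Lattice B] [SemilatticeSup U] [OrderBot U] (f : ConC A ≃o S)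
    (g : ConC B ≃o T) {μ ν : SemilatticeTensor S T ≃o U}
    (h : ∀ ⦃a₀ a₁ : A⦄, a₀ ≤ a₁ → ∀ ⦃b₀ b₁ : B⦄, b₀ ≤ b₁ →
      μ (tmul (f (ConC.principal a₀ a₁)) (g (ConC.principal b₀ b₁))) =
        ν (tmul (f (ConC.principal a₀ a₁)) (g (ConC.principal b₀ b₁)))) : μ = ν := by
  have bot_left : ∀ t : T, tmul (⊥ : S) t = ⊥ := fun t => Subtype.ext (BiIdeal.pure_bot_left t)
  have bot_right : ∀ s : S, tmul s (⊥ : T) = ⊥ := fun s => Subtype.ext (BiIdeal.pure_bot_right s)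
  have sup_left : ∀ (s s' : S) (t : T), tmul (s ⊔ s') t = tmul s t ⊔ tmul s' t :=
    fun s s' t => Subtype.ext (BiIdeal.pure_sup_left s s' t)
  have sup_right : ∀ (s : S) (t t' : T), tmul s (t ⊔ t') = tmul s t ⊔ tmul s t' :=
    fun s t t' => Subtype.ext (BiIdeal.pure_sup_right s t t')
  have key : ∀ α β, μ (tmul (f α) (g β)) = ν (tmul (f α) (g β)) := by
    intro α β
    refine ConC.induction (P := fun α => μ (tmul (f α) (g β)) = ν (tmul (f α) (g β)))
      ?_ (fun a a' => ?_) (fun α α' h k => ?_) α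
    · simp only [map_bot, bot_left]
    · refine ConC.induction (P := fun β => μ (tmul (f (ConC.principalLe a a')) (g β)) =
        ν (tmul (f (ConC.principalLe a a')) (g β))) ?_ (fun b b' => ?_) (fun β β' h k => ?_) β
      · simp only [map_bot, bot_right]
      -- By definition `principalLe a a'` is `principal (a ⊓ a') a`, whose arguments are comparable
      -- as `h` requires.
      · exact h inf_le_left inf_le_left
      · simp only [map_sup, sup_right, h, k]
    · simp only [map_sup, sup_left, h, k]
  ext I
  refine induction (P := fun I => μ I = ν I) (by simp only [map_bot]) (fun s t => ?_)
    (fun I J h k => by simp only [map_sup, h, k]) I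
  simpa using key (f.symm s) (g.symm t)

end SemilatticeTensor

theorem theoremA (S : Type u₁) [SemilatticeSup S] [OrderBot S]
    (T : Type u₂) [SemilatticeSup T] [OrderBot T] :
    (IsZeroRepresentable.{w₁} S → IsZeroRepresentable.{w₂} T →
      IsZeroRepresentable.{max w₁ w₂} (SemilatticeTensor S T)) ∧
    ∀ (A : Type w₁) [Lattice A] [OrderBot A] (B : Type w₂) [Lattice B] [OrderBot B]
      (f : ConC A ≃o S) (g : ConC B ≃o T),
      ∃! μ : SemilatticeTensor S T ≃o ConC (LatticeTensor A B),
        ∀ ⦃a₀ a₁ : A⦄, a₀ ≤ a₁ → ∀ ⦃b₀ b₁ : B⦄, b₀ ≤ b₁ →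
          μ (SemilatticeTensor.tmul (f (ConC.principal a₀ a₁)) (g (ConC.principal b₀ b₁))) =
            ConC.principal (LatticeTensor.tmul a₀ b₁ ⊔ LatticeTensor.tmul a₁ b₀)
              (LatticeTensor.tmul a₁ b₁) := by
  constructor
  · rintro ⟨A, _, _, ⟨f⟩⟩ ⟨B, _, _, ⟨g⟩⟩
    exact ⟨LatticeTensor A B, inferInstance, inferInstance,
      ⟨(SemilatticeTensor.isoConC f g).symm⟩⟩
  · intro A _ _ B _ _ f g
    refine ⟨SemilatticeTensor.isoConC f g,
      fun _ _ ha _ _ hb => SemilatticeTensor.isoConC_tmul f g ha hb, fun ν hν => ?_⟩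
    refine SemilatticeTensor.orderIso_ext f g fun _ _ ha _ _ hb => ?_
    rw [hν ha hb, SemilatticeTensor.isoConC_tmul f g ha hb]
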